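/- Let $R$ be an associative ring with identity that is abelian, meaning that every idempotent of $R$ is central, and let $n \ge 1$ be an integer. Write $J(R)$ for the Jacobson radical of $R$, $M_n(R)$ for the ring of $n \times n$ matrices over $R$, and $M_n(J(R))$ for the ideal of $M_n(R)$ consisting of the matrices with all entries in $J(R)$. A ring is called nil-clean if each of its elements is the sum of an idempotent and a nilpotent element, and Boolean if each of its elements is idempotent; an ideal is called nil if each of its elements is nilpotent. Then the following are equivalent: 1. $M_n(R)$ is nil-clean. 2. $R/J(R)$ is Boolean and $M_n(J(R))$ is nil. -/

import Mathlib

/-- A ring is abelian if every idempotent is central. -/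
def IsAbelianRing (R : Type*) [Ring R] : Prop :=
  ∀ e : R, IsIdempotentElem e → e ∈ Subring.center R

/-- An element is nil-clean if subtracting some idempotent from it leaves a nilpotent. -/
def IsNilCleanElem {R : Type*} [Ring R] (a : R) : Prop :=
  ∃ e : R, IsIdempotentElem e ∧ IsNilpotent (a - e)

/-- A ring is nil-clean if every element is nil-clean. -/
def IsNilCleanRing (R : Type*) [Ring R] : Prop :=
  ∀ a : R, IsNilCleanElem a

/-- A ring is Boolean if every element is idempotent. -/
def IsBooleanRing (R : Type*) [Ring R] : Prop :=
  ∀ a : R, IsIdempotentElem a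

/-- An ideal is nil if each of its elements is nilpotent. -/
def IsNilIdeal {R : Type*} [Ring R] (I : Ideal R) : Prop :=
  ∀ a ∈ I, IsNilpotent a

/-!
If `Mₙ(R)` is nil-clean then it is an exchange ring, hence so is its corner `R`, and in an abelian
exchange ring every maximal left ideal `M` is two-sided. So `D = R ⧸ M` is a division ring with
`Mₙ(D)` nil-clean; a rank-one endomorphism `v ↦ φ v • x` is nil-clean only if `φ x ∈ {0, 1}`, which
forces `D = {0, 1}`. Intersecting over all `M` shows that `R ⧸ J(R)` is Boolean.

Conversely, idempotents lift modulo a nil ideal, so it suffices to treat matrices over a Boolean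
ring. The entries of one matrix generate a finite Boolean ring, i.e. a finite product of copies of
`𝔽₂`, and an endomorphism of a finite-dimensional `𝔽₂`-space is nil-clean by induction on cyclic
invariant subspaces. A companion matrix is nilpotent up to an idempotent of rank one if its trace
is `1`, and up to an idempotent of rank two if its trace is `0 = 2` and its size is at least three.
-/

section NilClean

variable {R S : Type*} [Ring R] [Ring S]

theorem IsBooleanRing.two_eq_zero (hR : IsBooleanRing R) : (2 : R) = 0 := by
  have h : (2 : R) * 2 = 2 := hR 2
  rwa [two_mul, add_eq_left] at h

theorem IsNilCleanElem.of_isIdempotentElem {a : R} (ha : IsIdempotentElem a) :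
    IsNilCleanElem a :=
  ⟨a, ha, by simp⟩

theorem IsNilCleanElem.of_isIdempotentElem_sq (h2 : (2 : R) = 0) {a : R}
    (ha : IsIdempotentElem (a ^ 2)) : IsNilCleanElem a := by
  refine ⟨a ^ 2, ha, 2, ?_⟩
  calc (a - a ^ 2) ^ 2 = a ^ 2 - 2 * a ^ 3 + a ^ 2 * a ^ 2 := by noncomm_ring
    _ = 2 * a ^ 2 - 2 * a ^ 3 := by rw [ha.eq]; noncomm_ring
    _ = 0 := by simp only [h2, zero_mul, sub_zero]

theorem IsNilCleanElem.map (f : R →+* S) {a : R} (ha : IsNilCleanElem a) :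
    IsNilCleanElem (f a) := by
  obtain ⟨e, he, hn⟩ := ha
  exact ⟨f e, he.map f, map_sub f a e ▸ hn.map f⟩

theorem IsNilCleanRing.of_surjective (hR : IsNilCleanRing R) (f : R →+* S)
    (hf : Function.Surjective f) : IsNilCleanRing S :=
  hf.forall.2 fun a => (hR a).map f

theorem IsNilCleanRing.of_ker_isNilpotent (f : R →+* S) (hf : Function.Surjective f)
    (hker : ∀ x ∈ RingHom.ker f, IsNilpotent x) (hS : IsNilCleanRing S) : IsNilCleanRing R := by
  intro a
  obtain ⟨_, he, k, hk⟩ := hS (f a)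
  obtain ⟨e, he', rfl⟩ := exists_isIdempotentElem_eq_of_ker_isNilpotent f hker _ (hf _) he
  have hmem : (a - e) ^ k ∈ RingHom.ker f := by rw [RingHom.mem_ker, map_pow, map_sub, hk]
  exact ⟨e, he', (hker _ hmem).of_pow⟩

theorem IsNilCleanRing.pi {ι : Type*} [Finite ι] {A : ι → Type*} [∀ i, Ring (A i)]
    (hA : ∀ i, IsNilCleanRing (A i)) : IsNilCleanRing (∀ i, A i) := by
  have := Fintype.ofFinite ι
  intro a
  choose e he k hk using fun i => hA i (a i)
  refine ⟨e, funext he, Finset.univ.sup k, funext fun i => ?_⟩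
  exact pow_eq_zero_of_le (Finset.le_sup (Finset.mem_univ i)) (hk i)

end NilClean

section MapMatrix

variable {ι R S : Type*} [Fintype ι] [DecidableEq ι] [Semiring R] [Semiring S]

theorem mapMatrix_surjective {f : R →+* S}
    (hf : Function.Surjective f) : Function.Surjective (f.mapMatrix (m := ι)) := by
  intro A
  choose B hB using fun i j => hf (A i j)
  exact ⟨Matrix.of B, Matrix.ext hB⟩

theorem mem_matrix_ker_of_mem_ker_mapMatrix {f : R →+* S}
    {A : Matrix ι ι R} (hA : A ∈ RingHom.ker (f.mapMatrix : Matrix ι ι R →+* Matrix ι ι S)) :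
    A ∈ (RingHom.ker f).matrix ι :=
  fun i j => RingHom.mem_ker.2 (Matrix.ext_iff.2 (RingHom.mem_ker.1 hA) i j)

end MapMatrix

section Jacobson

variable {R : Type*} [Ring R]

theorem eq_zero_of_isIdempotentElem_of_mem_jacobson {e : R} (he : IsIdempotentElem e)
    (heJ : e ∈ Ring.jacobson R) : e = 0 := by
  rw [← Ideal.jacobson_bot] at heJ
  obtain ⟨s, hs⟩ := Ideal.exists_mul_sub_mem_of_sub_one_mem_jacobson (1 - e) (by simpa using heJ)
  calc e = s * (1 - e) * e := by rw [sub_eq_zero.1 hs, one_mul]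
    _ = 0 := by rw [mul_assoc, he.one_sub_mul_self, mul_zero]

theorem IsNilCleanRing.isNilIdeal_jacobson (hR : IsNilCleanRing R) :
    IsNilIdeal (Ring.jacobson R) := by
  intro a ha
  obtain ⟨e, he, hn⟩ := hR a
  let π := Ideal.Quotient.mk (Ring.jacobson R)
  have hπe : IsNilpotent (π e) := by
    have := hn.map π
    rwa [map_sub, Ideal.Quotient.eq_zero_iff_mem.2 ha, zero_sub, isNilpotent_neg_iff] at this
  have heJ : e ∈ Ring.jacobson R :=
    Ideal.Quotient.eq_zero_iff_mem.1 ((he.map π).eq_zero_of_isNilpotent hπe)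
  rwa [eq_zero_of_isIdempotentElem_of_mem_jacobson he heJ, sub_zero] at hn

theorem IsNilCleanRing.isNilIdeal_matrix_jacobson {ι : Type*} [Fintype ι] [DecidableEq ι]
    (h : IsNilCleanRing (Matrix ι ι R)) : IsNilIdeal ((Ring.jacobson R).matrix ι) := by
  intro A hA
  refine h.isNilIdeal_jacobson A ?_
  rw [← Ideal.jacobson_bot] at hA ⊢
  simpa only [Ideal.matrix_bot] using Ideal.matrix_jacobson_le ⊥ hA

end Jacobson

section Exchange

variable {R : Type*} [Ring R]

/-- Exchange rings, in Nicholson's characterisation: for every `a` there is an idempotent `e` with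
`e ∈ R a` and `1 - e ∈ R (1 - a)`. -/
def IsExchangeRing (R : Type*) [Ring R] : Prop :=
  ∀ a : R, ∃ e : R, IsIdempotentElem e ∧ e ∈ Ideal.span {a} ∧ 1 - e ∈ Ideal.span {1 - a}

theorem exists_exchange_of_eq_add_unit {a e : R} (he : IsIdempotentElem e) (u : Rˣ)
    (ha : a = e + u) :
    ∃ f : R, IsIdempotentElem f ∧ f ∈ Ideal.span {a} ∧ 1 - f ∈ Ideal.span {1 - a} := by
  have hcomm : (1 - e) * u = u * a - (a - 1) * a := by
    rw [ha]
    simp only [sub_mul, add_mul, mul_add, he.eq, one_mul]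
    abel
  have hf : ↑u⁻¹ * (1 - e) * u = a - ↑u⁻¹ * ((a - 1) * a) := by
    rw [mul_assoc, hcomm, mul_sub, Units.inv_mul_cancel_left]
  refine ⟨↑u⁻¹ * (1 - e) * u, ?_, Ideal.mem_span_singleton'.2 ⟨1 - ↑u⁻¹ * (a - 1), ?_⟩,
    Ideal.mem_span_singleton'.2 ⟨1 - ↑u⁻¹ * a, ?_⟩⟩
  · calc (↑u⁻¹ * (1 - e) * u) * (↑u⁻¹ * (1 - e) * u)
        = (↑u⁻¹ : R) * ((1 - e) * (u * ↑u⁻¹) * (1 - e)) * u := by simp only [mul_assoc]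
      _ = (↑u⁻¹ : R) * (1 - e) * u := by rw [Units.mul_inv, mul_one, he.one_sub.eq]
  · rw [hf]; noncomm_ring
  · rw [hf]; noncomm_ring

theorem IsNilCleanRing.isExchangeRing (hR : IsNilCleanRing R) : IsExchangeRing R := by
  intro a
  obtain ⟨e, he, hn⟩ := hR (a - 1)
  obtain ⟨u, hu⟩ := hn.isUnit_one_add
  exact exists_exchange_of_eq_add_unit he u (by rw [hu]; abel)

theorem IsExchangeRing.of_matrix {ι : Type*} [Fintype ι] [DecidableEq ι] [Nonempty ι]
    (h : IsExchangeRing (Matrix ι ι R)) : IsExchangeRing R := by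
  intro a
  obtain ⟨i⟩ := ‹Nonempty ι›
  obtain ⟨F, hF, hFa, hFa'⟩ := h (Matrix.single i i a)
  obtain ⟨s, rfl⟩ := Ideal.mem_span_singleton'.1 hFa
  obtain ⟨t, ht⟩ := Ideal.mem_span_singleton'.1 hFa'
  refine ⟨(s * Matrix.single i i a) i i, ?_, Ideal.mem_span_singleton'.2 ⟨s i i, ?_⟩,
    Ideal.mem_span_singleton'.2 ⟨t i i, ?_⟩⟩
  · have hii := congrFun₂ hF.eq i i
    rwa [Matrix.mul_apply, Finset.sum_eq_single i (fun j _ hj => by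
      rw [Matrix.mul_single_apply_of_ne (hbj := hj), zero_mul]) (by simp)] at hii
  · rw [Matrix.mul_single_apply_same]
  · have hii := congrFun₂ ht i i
    rwa [mul_sub, mul_one, Matrix.sub_apply, Matrix.mul_single_apply_same, Matrix.sub_apply,
      Matrix.one_apply_eq, ← mul_one_sub] at hii

theorem IsAbelianRing.mul_eq_mul_mul_mul (hR : IsAbelianRing R) {p r : R}
    (hpr : IsIdempotentElem (p * r)) : p * r = r * (p * r) * p := by
  have hqq : IsIdempotentElem (r * (p * r) * p) := by
    calc r * (p * r) * p * (r * (p * r) * p) = r * ((p * r) * (p * r) * (p * r)) * p := by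
          simp only [mul_assoc]
      _ = r * (p * r) * p := by rw [hpr.eq, hpr.eq]
  have hgc : ∀ x, x * (p * r) = p * r * x := Subring.mem_center_iff.1 (hR _ hpr)
  have hqc : ∀ x, x * (r * (p * r) * p) = r * (p * r) * p * x :=
    Subring.mem_center_iff.1 (hR _ hqq)
  calc p * r = (p * r) * (p * r) * (p * r) := by rw [hpr.eq, hpr.eq]
    _ = p * (r * (p * r) * p) * r := by simp only [mul_assoc]
    _ = r * (p * r) * (p * (p * r)) := by rw [hqc]; simp only [mul_assoc]
    _ = r * ((p * r) * (p * r)) * p := by rw [hgc p]; simp only [mul_assoc]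
    _ = r * (p * r) * p := by rw [hpr.eq]

theorem IsExchangeRing.isTwoSided_of_isMaximal (hex : IsExchangeRing R) (hR : IsAbelianRing R)
    {M : Ideal R} (hM : M.IsMaximal) : M.IsTwoSided := by
  refine ⟨fun {m} r hm => ?_⟩
  by_contra hmr
  obtain ⟨s, m', hm', hs⟩ := Ideal.IsMaximal.exists_inv hM hmr
  obtain ⟨g, hg, hgs, hgs'⟩ := hex (s * (m * r))
  have h1g : 1 - g ∈ M := by
    refine (Ideal.span_singleton_le_iff_mem M).2 ?_ hgs'
    rwa [← hs, add_sub_cancel_left]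
  obtain ⟨t, rfl⟩ := Ideal.mem_span_singleton'.1 hgs
  have hassoc : t * (s * (m * r)) = (t * s * m) * r := by simp only [mul_assoc]
  have hgM : t * (s * (m * r)) ∈ M := by
    rw [hassoc] at hg ⊢
    rw [hR.mul_eq_mul_mul_mul hg]
    exact M.mul_mem_left _ (M.mul_mem_left _ hm)
  exact hM.ne_top ((Ideal.eq_top_iff_one M).2 (by simpa using M.add_mem h1g hgM))

end Exchange

section DivisionRing

open Module

theorem eq_zero_of_isNilpotent_of_apply_apply_eq {D V : Type*} [Ring D] [IsDomain D]
    [AddCommGroup V] [Module D V] [IsTorsionFree D V] {N : End D V} (hN : IsNilpotent N)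
    {c d : D} (hd : d ≠ 0) {u : V} (hu : N (N u) = c • N u + d • u) : u = 0 := by
  obtain ⟨k, hk⟩ := hN
  have hdesc : ∀ j, (N ^ j) u = 0 → u = 0 := by
    intro j
    induction j with
    | zero => exact id
    | succ j ih =>
      intro hj
      rw [pow_succ, End.mul_apply] at hj
      have hj' : (N ^ j) (N (N u)) = N ((N ^ j) (N u)) :=
        LinearMap.congr_fun (Commute.pow_self N j).eq (N u)
      rw [hu, map_add, map_smul, map_smul, hj, map_zero, smul_zero, zero_add] at hj'
      exact ih ((smul_eq_zero.1 hj').resolve_left hd)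
  exact hdesc k (by rw [hk, LinearMap.zero_apply])

theorem eq_zero_of_isNilpotent_of_apply_eq_smul {D V : Type*} [Ring D] [IsDomain D]
    [AddCommGroup V] [Module D V] [IsTorsionFree D V] {N : End D V} (hN : IsNilpotent N)
    {c : D} (hc : c ≠ 0) {u : V} (hu : N u = c • u) : u = 0 :=
  eq_zero_of_isNilpotent_of_apply_apply_eq hN (c := 0) (mul_ne_zero hc hc) <| by
    rw [hu, map_smul, hu, zero_smul, zero_add, mul_smul]

variable {D V : Type*} [DivisionRing D] [AddCommGroup V] [Module D V]

theorem exists_forall_apply_eq_smul_of_ker_disjoint {E : End D V} (hE : IsIdempotentElem E)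
    (hE0 : E ≠ 0) {φ : V →ₗ[D] D} (hφ : ∀ v, φ (E v) = 0 → E v = 0) :
    ∃ u, φ u = 1 ∧ E u = u ∧ ∀ v, E v = φ (E v) • u := by
  obtain ⟨y, hy⟩ : ∃ y, φ (E y) ≠ 0 := by
    by_contra! h
    exact hE0 (LinearMap.ext fun v => hφ v (h v))
  have hEE : ∀ v, E (E v) = E v := LinearMap.congr_fun hE.eq
  set u := (φ (E y))⁻¹ • E y with hu
  have hφu : φ u = 1 := by rw [hu, map_smul, smul_eq_mul, inv_mul_cancel₀ hy]
  have hEu : E u = u := by rw [hu, map_smul, hEE]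
  refine ⟨u, hφu, hEu, fun v => ?_⟩
  have hsub : E (v - φ (E v) • u) = E v - φ (E v) • u := by rw [map_sub, map_smul, hEu]
  refine sub_eq_zero.1 (hsub ▸ hφ _ ?_)
  rw [hsub, map_sub, map_smul, hφu, smul_eq_mul, mul_one, sub_self]

theorem apply_eq_zero_or_one_of_isNilCleanElem_smulRight {φ : V →ₗ[D] D} {x : V}
    (h : IsNilCleanElem (R := End D V) (φ.smulRight x)) : φ x = 0 ∨ φ x = 1 := by
  obtain ⟨E, hE, hN⟩ := h
  by_contra! hφx
  have hx : x ≠ 0 := fun hx => hφx.1 (hx ▸ map_zero φ)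
  set N : End D V := φ.smulRight x - E
  have hN_apply : ∀ v, N v = φ v • x - E v := fun _ => rfl
  have hEE : ∀ v, E (E v) = E v := LinearMap.congr_fun hE.eq
  have hE0 : E ≠ 0 := fun hE0 => hx <| eq_zero_of_isNilpotent_of_apply_eq_smul hN hφx.1 <| by
    rw [hN_apply, hE0, LinearMap.zero_apply, sub_zero]
  have hker : ∀ v, φ (E v) = 0 → E v = 0 := fun v hv =>
    eq_zero_of_isNilpotent_of_apply_eq_smul hN (neg_ne_zero.2 one_ne_zero) <| by
      rw [hN_apply, hv, hEE, zero_smul, zero_sub, neg_one_smul]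
  obtain ⟨u, hφu, hEu, hEφ⟩ := exists_forall_apply_eq_smul_of_ker_disjoint hE hE0 hker
  have hu0 : u ≠ 0 := fun hu => one_ne_zero (hφu.symm.trans (hu ▸ map_zero φ))
  have hNu : N u = x - u := by rw [hN_apply, hφu, hEu, one_smul]
  have hNNu : N (N u) = (φ x - 1) • N u + (φ x - φ (E x)) • u := by
    calc N (N u) = φ x • x - φ (E x) • u - (x - u) := by
          rw [hNu, map_sub, hNu, hN_apply x, ← hEφ x]
      _ = (φ x - 1) • N u + (φ x - φ (E x)) • u := by
          rw [hNu]
          simp only [sub_smul, smul_sub, one_smul]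
          abel
  by_cases hx' : φ x = φ (E x)
  · rw [hx', sub_self, zero_smul, add_zero, ← hx'] at hNNu
    have hNu0 := eq_zero_of_isNilpotent_of_apply_eq_smul hN (sub_ne_zero.2 hφx.2) hNNu
    rw [hNu, sub_eq_zero] at hNu0
    exact hφx.2 (hNu0 ▸ hφu)
  · exact hu0 (eq_zero_of_isNilpotent_of_apply_apply_eq hN (sub_ne_zero.2 hx') hNNu)

theorem IsNilCleanRing.eq_zero_or_one_of_end [Nontrivial V] (h : IsNilCleanRing (End D V))
    (c : D) : c = 0 ∨ c = 1 := by
  obtain ⟨x, hx⟩ := exists_ne (0 : V)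
  obtain ⟨φ, hφ⟩ := (LinearMap.toSpanSingleton D V x).exists_leftInverse_of_injective
    (LinearMap.ker_toSpanSingleton D hx)
  have hφc : φ (c • x) = c := LinearMap.congr_fun hφ c
  exact hφc ▸ apply_eq_zero_or_one_of_isNilCleanElem_smulRight (h (φ.smulRight (c • x)))

theorem IsNilCleanRing.eq_zero_or_one_of_matrix {ι : Type*} [Fintype ι] [DecidableEq ι]
    [Nonempty ι] (h : IsNilCleanRing (Matrix ι ι D)) (c : D) : c = 0 ∨ c = 1 := by
  let toEnd : Matrix ι ι D ≃+* End Dᵐᵒᵖ (ι → D) :=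
    (RingEquiv.moduleEndSelfOp D).mapMatrix.trans (endVecRingEquivMatrixEnd ι Dᵐᵒᵖ D).symm
  simpa using (h.of_surjective toEnd.toRingHom toEnd.surjective).eq_zero_or_one_of_end
    (MulOpposite.op c)

end DivisionRing

section QuotientByJacobson

variable {R : Type*} [Ring R]

theorem isUnit_or_eq_zero_of_isMaximal (M : Ideal R) [M.IsTwoSided] (hM : M.IsMaximal)
    (x : R ⧸ M) : IsUnit x ∨ x = 0 := by
  have hsimple : IsSimpleModule R (R ⧸ M) := isSimpleModule_iff_isCoatom.2 hM.out
  have hself : IsSimpleModule (R ⧸ M) (R ⧸ M) := by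
    refine isSimpleModule_iff_toSpanSingleton_surjective.2
      ⟨hsimple.nontrivial, fun x hx y => ?_⟩
    obtain ⟨r, hr⟩ := hsimple.toSpanSingleton_surjective R hx y
    exact ⟨Ideal.Quotient.mk M r, hr⟩
  exact or_iff_not_imp_right.2 ((isSimpleModule_self_iff_isUnit.1 hself).2 x)

theorem IsNilCleanRing.isBooleanRing_quotient_jacobson {ι : Type*} [Fintype ι] [DecidableEq ι]
    [Nonempty ι] (h : IsNilCleanRing (Matrix ι ι R)) (hR : IsAbelianRing R) :
    IsBooleanRing (R ⧸ Ring.jacobson R) := by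
  refine Ideal.Quotient.mk_surjective.forall.2 fun a => ?_
  rw [IsIdempotentElem, ← map_mul, Ideal.Quotient.eq, Ring.jacobson_eq_sInf_isMaximal,
    Ideal.mem_sInf]
  intro M hM
  have : M.IsTwoSided := h.isExchangeRing.of_matrix.isTwoSided_of_isMaximal hR hM
  have : Nontrivial (R ⧸ M) := Ideal.Quotient.nontrivial_iff.2 hM.ne_top
  let _ : DivisionRing (R ⧸ M) :=
    DivisionRing.ofIsUnitOrEqZero (isUnit_or_eq_zero_of_isMaximal M hM)
  have hD : IsNilCleanRing (Matrix ι ι (R ⧸ M)) :=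
    h.of_surjective _ (mapMatrix_surjective Ideal.Quotient.mk_surjective)
  rw [← Ideal.Quotient.eq, map_mul]
  exact IsIdempotentElem.iff_eq_zero_or_one.2 (hD.eq_zero_or_one_of_matrix _)

end QuotientByJacobson

section InvariantSubmodule

open Module

theorem isNilpotent_of_restrict_of_mapQ {K V : Type*} [Ring K] [AddCommGroup V] [Module K V]
    {N : End K V} {W : Submodule K V} (hW : ∀ x ∈ W, N x ∈ W)
    (h₁ : IsNilpotent (N.restrict hW : End K W))
    (h₂ : IsNilpotent (W.mapQ W N hW : End K (V ⧸ W))) : IsNilpotent N := by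
  obtain ⟨k₁, hk₁⟩ := h₁
  obtain ⟨k₂, hk₂⟩ := h₂
  refine ⟨k₁ + k₂, LinearMap.ext fun x => ?_⟩
  have hmem : (N ^ k₂) x ∈ W := by
    rw [← W.mapQ_pow hW] at hk₂
    exact (Submodule.Quotient.mk_eq_zero W).1 (LinearMap.congr_fun hk₂ (W.mkQ x))
  rw [End.pow_restrict] at hk₁
  rw [pow_add, End.mul_apply]
  exact congrArg Subtype.val (LinearMap.congr_fun hk₁ ⟨(N ^ k₂) x, hmem⟩)

theorem exists_isIdempotentElem_of_subspace_of_quotient {K V : Type*} [DivisionRing K]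
    [AddCommGroup V] [Module K V] {W : Submodule K V} {E₁ : End K W} (h₁ : IsIdempotentElem E₁)
    {E₂ : End K (V ⧸ W)} (h₂ : IsIdempotentElem E₂) :
    ∃ E : End K V, IsIdempotentElem E ∧ (∀ w : W, E w = E₁ w) ∧
      ∀ v, W.mkQ (E v) = E₂ (W.mkQ v) := by
  obtain ⟨p, hp⟩ := W.subtype.exists_leftInverse_of_injective W.ker_subtype
  have hpW : ∀ w : W, p w = w := LinearMap.congr_fun hp
  have hcompl : IsCompl (LinearMap.ker p) (LinearMap.ker W.mkQ) := by
    rw [W.ker_mkQ]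
    exact (LinearMap.isCompl_of_proj hpW).symm
  let split : V ≃ₗ[K] W × (V ⧸ W) := LinearMap.equivProdOfSurjectiveOfIsCompl p W.mkQ
    (LinearMap.range_eq_top.2 fun w => ⟨w, hpW w⟩) W.range_mkQ hcompl
  have hsplit : ∀ v, split v = (p v, W.mkQ v) := fun _ => rfl
  have hE₁₂ : IsIdempotentElem (E₁.prodMap E₂ : End K (W × (V ⧸ W))) := by
    rw [IsIdempotentElem, LinearMap.prodMap_mul, h₁.eq, h₂.eq]
  refine ⟨split.symm.conjRingEquiv (E₁.prodMap E₂), hE₁₂.map split.symm.conjRingEquiv,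
    fun w => ?_, fun v => ?_⟩
  · change split.symm (E₁.prodMap E₂ (split w)) = E₁ w
    have hmkQ : ∀ w : W, W.mkQ w = 0 := fun w => (Submodule.Quotient.mk_eq_zero W).2 w.2
    rw [LinearEquiv.symm_apply_eq, hsplit, hsplit, LinearMap.prodMap_apply, hpW, hpW, hmkQ, hmkQ,
      map_zero]
  · exact congrArg Prod.snd (split.apply_symm_apply (E₁.prodMap E₂ (split v)))

theorem isNilCleanElem_of_restrict_of_mapQ {K V : Type*} [DivisionRing K] [AddCommGroup V]
    [Module K V] {T : End K V} {W : Submodule K V} (hW : ∀ x ∈ W, T x ∈ W)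
    (h₁ : IsNilCleanElem (R := End K W) (T.restrict hW))
    (h₂ : IsNilCleanElem (R := End K (V ⧸ W)) (W.mapQ W T hW)) : IsNilCleanElem T := by
  obtain ⟨E₁, hE₁, hN₁⟩ := h₁
  obtain ⟨E₂, hE₂, hN₂⟩ := h₂
  obtain ⟨E, hE, hEW, hEQ⟩ := exists_isIdempotentElem_of_subspace_of_quotient hE₁ hE₂
  have hW' : ∀ x ∈ W, (T - E) x ∈ W := fun x hx =>
    W.sub_mem (hW x hx) (hEW ⟨x, hx⟩ ▸ (E₁ ⟨x, hx⟩).2)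
  have hrestrict : (T - E).restrict hW' = T.restrict hW - E₁ :=
    LinearMap.ext fun w => Subtype.ext (congrArg (T w - ·) (hEW w))
  have hmapQ : W.mapQ W (T - E) hW' = W.mapQ W T hW - E₂ :=
    W.linearMap_qext (LinearMap.ext fun v => congrArg (W.mkQ (T v) - ·) (hEQ v))
  exact ⟨E, hE, isNilpotent_of_restrict_of_mapQ hW' (hrestrict ▸ hN₁) (hmapQ ▸ hN₂)⟩

end InvariantSubmodule

section Cyclic

open Module

section Ring

variable {K V : Type*} [Ring K] [AddCommGroup V] [Module K V] {T E : End K V} {v : V}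

theorem isIdempotentElem_smulRight {φ : V →ₗ[K] K} {a : V} (ha : φ a = 1) :
    IsIdempotentElem (φ.smulRight a : End K V) :=
  LinearMap.ext fun x => by simp [ha]

theorem isIdempotentElem_smulRight_add_smulRight {φ ψ : V →ₗ[K] K} {a y : V} (hφa : φ a = 1)
    (hφy : φ y = 0) (hψa : ψ a = 0) (hψy : ψ y = 1) :
    IsIdempotentElem (φ.smulRight a + ψ.smulRight y : End K V) :=
  LinearMap.ext fun x => by simp [hφa, hφy, hψa, hψy]

theorem pow_sub_apply_eq_pow_apply {k : ℕ} (hE : ∀ i < k, E ((T ^ i) v) = 0) :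
    ∀ i ≤ k, ((T - E) ^ i) v = (T ^ i) v
  | 0, _ => rfl
  | i + 1, hi => by
    rw [pow_succ', End.mul_apply, pow_sub_apply_eq_pow_apply hE i (by lia), LinearMap.sub_apply,
      hE i hi, sub_zero, pow_succ', End.mul_apply]

theorem isNilpotent_sub_of_span_orbit (v : V) (k : ℕ) {a : V}
    (hE : ∀ i < k, E ((T ^ i) v) = 0) (hEk : E ((T ^ k) v) = a)
    (hEe : E ((T ^ (k + 1)) v - a) = T ((T ^ (k + 1)) v - a))
    (ha : a ∈ Submodule.span K ((fun i => (T ^ i) v) '' Set.Iic k))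
    (hspan : Submodule.span K ((fun i => (T ^ i) v) '' Set.Iic (k + 1)) = ⊤) :
    IsNilpotent (T - E) := by
  have horbit : ∀ i ≤ k, ((T - E) ^ i) v = (T ^ i) v := pow_sub_apply_eq_pow_apply hE
  have horbit_succ : ((T - E) ^ (k + 1)) v = (T ^ (k + 1)) v - a := by
    rw [pow_succ', End.mul_apply, horbit k le_rfl, LinearMap.sub_apply, hEk, pow_succ',
      End.mul_apply]
  have hkill : ∀ i, ((T - E) ^ i) v ∈ LinearMap.ker ((T - E) ^ (k + 2)) := fun i => by
    rw [LinearMap.mem_ker, ← End.mul_apply, ← pow_add, add_comm, pow_add, End.mul_apply, pow_succ',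
      End.mul_apply, horbit_succ, LinearMap.sub_apply, hEe, sub_self, map_zero]
  have hkill_orbit : ∀ i ≤ k, (T ^ i) v ∈ LinearMap.ker ((T - E) ^ (k + 2)) := fun i hi =>
    horbit i hi ▸ hkill i
  have hkill_a : a ∈ LinearMap.ker ((T - E) ^ (k + 2)) := by
    refine Submodule.span_le.2 ?_ ha
    rintro _ ⟨i, hi, rfl⟩
    exact hkill_orbit i hi
  refine ⟨k + 2, LinearMap.ker_eq_top.1 (top_le_iff.1 (hspan ▸ Submodule.span_le.2 ?_))⟩
  rintro _ ⟨i, hi, rfl⟩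
  rcases Nat.le_succ_iff.1 hi with hi | rfl
  · exact hkill_orbit i hi
  · exact ((LinearMap.ker _).sub_mem_iff_left hkill_a).1 (horbit_succ ▸ hkill (k + 1))

/-- `b` is the basis `v, T v, …, T ^ (d - 1) v`. The matrix of `T` in such a basis is a companion
matrix, whose trace is the last coordinate of `T ^ d v`. -/
def IsCyclicBasis {d : ℕ} (T : End K V) (v : V) (b : Basis (Fin d) K V) : Prop :=
  ∀ i, b i = (T ^ (i : ℕ)) v

theorem IsCyclicBasis.coord_pow {d : ℕ} {b : Basis (Fin d) K V} (hb : IsCyclicBasis T v b)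
    (j : Fin d) {i : ℕ} (hi : i < d) : b.coord j ((T ^ i) v) = if i = j then 1 else 0 := by
  rw [← hb ⟨i, hi⟩, b.coord_apply, b.repr_self, Finsupp.single_apply]
  simp only [Fin.ext_iff]

theorem IsCyclicBasis.span_image_Iic {d k : ℕ} {b : Basis (Fin d) K V} (hb : IsCyclicBasis T v b)
    (hk : d ≤ k + 1) : Submodule.span K ((fun i => (T ^ i) v) '' Set.Iic k) = ⊤ := by
  rw [← top_le_iff, ← b.span_eq]
  refine Submodule.span_mono ?_
  rintro _ ⟨i, rfl⟩
  exact ⟨i, by grind, (hb i).symm⟩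

theorem IsCyclicBasis.eq_zero_of_coord_eq_zero {b : Basis (Fin 1) K V} (hb : IsCyclicBasis T v b)
    (h : b.coord 0 (T v) = 0) : T = 0 := by
  refine b.ext fun i => b.ext_elem fun j => ?_
  rw [Subsingleton.elim i 0, Subsingleton.elim j 0, hb 0]
  simpa using h

theorem IsCyclicBasis.isNilCleanElem_of_coord_eq_one {m : ℕ} {b : Basis (Fin (m + 1)) K V}
    (hb : IsCyclicBasis T v b) (htrace : b.coord (Fin.last m) ((T ^ (m + 1)) v) = 1) :
    IsNilCleanElem T := by
  set φ := b.coord (Fin.last m)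
  have hφ : ∀ i < m, φ ((T ^ i) v) = 0 := fun i hi => by
    rw [hb.coord_pow _ (by lia), if_neg (by simpa using hi.ne)]
  have hφm : φ ((T ^ m) v) = 1 := by rw [hb.coord_pow _ (by lia), if_pos (by simp)]
  refine ⟨φ.smulRight ((T ^ (m + 1)) v), isIdempotentElem_smulRight htrace,
    isNilpotent_sub_of_span_orbit v m (fun i hi => ?_) (a := (T ^ (m + 1)) v) ?_ (by simp) ?_
      (hb.span_image_Iic (by lia))⟩
  · rw [LinearMap.smulRight_apply, hφ i hi, zero_smul]
  · rw [LinearMap.smulRight_apply, hφm, one_smul]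
  · rw [hb.span_image_Iic le_rfl]
    exact Submodule.mem_top

theorem IsCyclicBasis.isNilCleanElem_of_coord_eq_two {m : ℕ} {b : Basis (Fin (m + 3)) K V}
    (hb : IsCyclicBasis T v b) (htrace : b.coord (Fin.last (m + 2)) ((T ^ (m + 3)) v) = 2) :
    IsNilCleanElem T := by
  set ψ := b.coord (Fin.last (m + 2))
  set χ := b.coord ⟨m + 1, by lia⟩
  have hψ : ∀ i < m + 3, ψ ((T ^ i) v) = if i = m + 2 then 1 else 0 := fun i => hb.coord_pow _
  have hχ : ∀ i < m + 3, χ ((T ^ i) v) = if i = m + 1 then 1 else 0 := fun i => hb.coord_pow _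
  -- The idempotent `φ ⊗ a + ψ ⊗ T e` is arranged so that subtracting it from `T` gives a map that
  -- sends `T ^ (m + 1) v` to `e` and kills `e`; the scalar `c` is what makes `φ (T e)` vanish.
  let c : K := χ ((T ^ (m + 3)) v) + 1
  let a : V := (T ^ (m + 1)) v + c • (T ^ m) v
  let e : V := (T ^ (m + 2)) v - a
  let φ : V →ₗ[K] K := χ + ψ
  have hφ : ∀ i < m + 1, φ ((T ^ i) v) = 0 := fun i hi => by
    simp [φ, hψ i (by lia), hχ i (by lia), hi.ne, show i ≠ m + 2 by lia]
  have hTe : T e = (T ^ (m + 3)) v - ((T ^ (m + 2)) v + c • (T ^ (m + 1)) v) := by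
    simp only [e, a, map_sub, map_add, map_smul, ← End.mul_apply, ← pow_succ']
  have hφa : φ a = 1 := by simp [φ, a, hψ, hχ]
  have hψa : ψ a = 0 := by simp [a, hψ]
  have hφe : φ e = 0 := by
    rw [map_sub, hφa, sub_eq_zero]
    simp [φ, hψ, hχ]
  have hψe : ψ e = 1 := by simp [e, hψa, hψ]
  have hψTe : ψ (T e) = 1 := by
    rw [hTe, map_sub, map_add, map_smul, htrace, hψ _ (by lia), hψ _ (by lia), if_pos rfl,
      if_neg (by lia), smul_zero, add_zero, ← one_add_one_eq_two, add_sub_cancel_right]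
  have hχTe : χ (T e) = -1 := by simp [hTe, hχ, c]
  have hφTe : φ (T e) = 0 := by rw [LinearMap.add_apply, hχTe, hψTe, neg_add_cancel]
  refine ⟨φ.smulRight a + ψ.smulRight (T e),
    isIdempotentElem_smulRight_add_smulRight hφa hφTe hψa hψTe,
    isNilpotent_sub_of_span_orbit v (m + 1) (fun i hi => ?_) (a := a) ?_ ?_ ?_
      (hb.span_image_Iic le_rfl)⟩
  · simp [hφ i hi, hψ i (by lia), show i ≠ m + 2 by lia]
  · simp [φ, hψ, hχ]
  · change φ e • a + ψ e • T e = T e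
    rw [hφe, hψe, zero_smul, one_smul, zero_add]
  · exact add_mem (Submodule.subset_span ⟨m + 1, by simp, rfl⟩)
      (Submodule.smul_mem _ c (Submodule.subset_span ⟨m, by simp, rfl⟩))

end Ring

section DivisionRing

variable {K V : Type*} [DivisionRing K] [AddCommGroup V] [Module K V]

theorem exists_linearIndependent_pow_and_pow_mem_span [FiniteDimensional K V] (T : End K V)
    (v : V) : ∃ d : ℕ, LinearIndependent K (fun i : Fin d => (T ^ (i : ℕ)) v) ∧
      (T ^ d) v ∈ Submodule.span K (Set.range fun i : Fin d => (T ^ (i : ℕ)) v) := by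
  by_contra! h
  have hli : ∀ d : ℕ, LinearIndependent K (fun i : Fin d => (T ^ (i : ℕ)) v) := by
    intro d
    induction d with
    | zero => exact linearIndependent_empty_type
    | succ d ih => exact linearIndependent_finSucc'.2 ⟨ih, h d ih⟩
  have hcard := (hli (finrank K V + 1)).fintype_card_le_finrank
  rw [Fintype.card_fin] at hcard
  exact Nat.not_succ_le_self _ hcard

theorem exists_isCyclicBasis_restrict [FiniteDimensional K V] (T : End K V) (v : V) :
    ∃ (W : Submodule K V) (hW : ∀ x ∈ W, T x ∈ W) (hv : v ∈ W) (d : ℕ) (b : Basis (Fin d) K W),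
      IsCyclicBasis (T.restrict hW) ⟨v, hv⟩ b := by
  obtain ⟨d, hli, hd⟩ := exists_linearIndependent_pow_and_pow_mem_span T v
  set W := Submodule.span K (Set.range fun i : Fin d => (T ^ (i : ℕ)) v)
  have hpow : ∀ i ≤ d, (T ^ i) v ∈ W := fun i hi => hi.lt_or_eq.elim
    (fun hi => Submodule.subset_span ⟨⟨i, hi⟩, rfl⟩) (fun hi => hi ▸ hd)
  have hW : W ≤ W.comap T := by
    refine Submodule.span_le.2 ?_
    rintro _ ⟨i, rfl⟩
    change T ((T ^ (i : ℕ)) v) ∈ W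
    rw [← End.mul_apply, ← pow_succ']
    exact hpow (i + 1) i.isLt
  refine ⟨W, hW, hpow 0 d.zero_le, d, Basis.span hli, fun i => Subtype.ext ?_⟩
  rw [Basis.span_apply, End.pow_restrict]
  rfl

end DivisionRing

theorem IsCyclicBasis.sq_eq_smul_one_of_coord_eq_zero {K V : Type*} [CommRing K]
    [AddCommGroup V] [Module K V] {T : End K V} {v : V} {b : Basis (Fin 2) K V}
    (hb : IsCyclicBasis T v b) (h : b.coord 1 ((T ^ 2) v) = 0) :
    T ^ 2 = b.coord 0 ((T ^ 2) v) • (1 : End K V) := by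
  have hv : (T ^ 2) v = b.coord 0 ((T ^ 2) v) • v := by
    have hsum := b.sum_repr ((T ^ 2) v)
    rw [Fin.sum_univ_two, ← b.coord_apply, ← b.coord_apply, h, zero_smul, add_zero, hb 0] at hsum
    exact hsum.symm
  refine b.ext fun i => ?_
  rw [hb i, LinearMap.smul_apply, End.one_apply, ← map_smul, ← hv, ← End.mul_apply,
    ← End.mul_apply, ← pow_add, ← pow_add, add_comm]

section Field

variable {K V : Type*} [Field K] [AddCommGroup V] [Module K V] {T : End K V} {v : V}

theorem IsCyclicBasis.isNilCleanElem (hK : IsBooleanRing K) {d : ℕ}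
    {b : Basis (Fin d) K V} (hb : IsCyclicBasis T v b) : IsNilCleanElem T := by
  have h01 : ∀ x : K, x = 0 ∨ x = 1 := fun x => IsIdempotentElem.iff_eq_zero_or_one.1 (hK x)
  have h2 : (2 : K) = 0 := hK.two_eq_zero
  have of_eq_zero (hT : T = 0) : IsNilCleanElem T := .of_isIdempotentElem (hT ▸ .zero)
  match d, b, hb with
  | 0, b, _ => exact of_eq_zero (b.ext fun i => i.elim0)
  | m + 1, b, hb =>
    rcases h01 (b.coord (Fin.last m) ((T ^ (m + 1)) v)) with htrace | htrace
    · match m, b, hb, htrace with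
      | 0, b, hb, htrace => exact of_eq_zero (hb.eq_zero_of_coord_eq_zero htrace)
      | 1, b, hb, htrace =>
        have h2' : (2 : End K V) = 0 := by rw [← map_ofNat (algebraMap K (End K V)), h2, map_zero]
        refine .of_isIdempotentElem_sq h2' ?_
        rw [hb.sq_eq_smul_one_of_coord_eq_zero htrace]
        rcases h01 (b.coord 0 ((T ^ 2) v)) with h | h
        · rw [h, zero_smul]; exact .zero
        · rw [h, one_smul]; exact .one
      | m + 2, b, hb, htrace => exact hb.isNilCleanElem_of_coord_eq_two (htrace.trans h2.symm)
    · exact hb.isNilCleanElem_of_coord_eq_one htrace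

theorem IsBooleanRing.isNilCleanRing_end (hK : IsBooleanRing K) (V : Type*) [AddCommGroup V]
    [Module K V] [FiniteDimensional K V] : IsNilCleanRing (End K V) := by
  intro T
  induction hn : finrank K V using Nat.strong_induction_on generalizing V with
  | _ n ih =>
  rcases subsingleton_or_nontrivial V with hV | hV
  · exact .of_isIdempotentElem (Subsingleton.elim _ _)
  obtain ⟨v, hv⟩ := exists_ne (0 : V)
  obtain ⟨W, hW, hvW, d, b, hb⟩ := exists_isCyclicBasis_restrict T v
  have : Nontrivial W := ⟨⟨v, hvW⟩, 0, fun h => hv (congrArg Subtype.val h)⟩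
  have hlt : finrank K (V ⧸ W) < n := by
    have hpos : 0 < finrank K W := finrank_pos
    have hadd := W.finrank_quotient_add_finrank
    lia
  exact isNilCleanElem_of_restrict_of_mapQ hW (hb.isNilCleanElem hK) (ih _ hlt _ _ rfl)

end Field

end Cyclic

section Boolean

theorem IsBooleanRing.isNilCleanRing_matrix_of_field {K ι : Type*} [Field K] [Fintype ι]
    [DecidableEq ι] (hK : IsBooleanRing K) : IsNilCleanRing (Matrix ι ι K) :=
  (hK.isNilCleanRing_end (ι → K)).of_surjective Matrix.toLinAlgEquiv'.symm.toRingEquiv.toRingHom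
    Matrix.toLinAlgEquiv'.symm.surjective

theorem IsBooleanRing.isNilCleanRing_matrix_of_finite {B ι : Type*} [CommRing B] [Finite B]
    [Fintype ι] [DecidableEq ι] (hB : IsBooleanRing B) : IsNilCleanRing (Matrix ι ι B) := by
  have : IsReduced B := ⟨fun x hx => (hB x).eq_zero_of_isNilpotent hx⟩
  let split : Matrix ι ι B ≃+* ∀ I : MaximalSpectrum B, Matrix ι ι (B ⧸ I.asIdeal) :=
    (IsArtinianRing.equivPi B).toRingEquiv.mapMatrix.trans Matrix.piRingEquiv
  refine IsNilCleanRing.of_surjective (.pi fun I => ?_) split.symm.toRingHom split.symm.surjective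
  let _ : Field (B ⧸ I.asIdeal) := Ideal.Quotient.field _
  have hI : IsBooleanRing (B ⧸ I.asIdeal) :=
    Ideal.Quotient.mk_surjective.forall.2 fun x => (hB x).map (Ideal.Quotient.mk I.asIdeal)
  exact hI.isNilCleanRing_matrix_of_field

theorem IsBooleanRing.finite_adjoin {B : Type*} [CommRing B] (hB : IsBooleanRing B) {s : Set B}
    (hs : s.Finite) : Finite (Algebra.adjoin ℤ s) := by
  have : Module.Finite ℤ (Algebra.adjoin ℤ s) := by
    refine Algebra.finite_adjoin_of_finite_of_isIntegral hs fun x _ =>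
      ⟨Polynomial.X ^ 2 - Polynomial.X, Polynomial.monic_X_pow_sub (by simp), ?_⟩
    rw [Polynomial.eval₂_sub, Polynomial.eval₂_X_pow, Polynomial.eval₂_X, pow_two, (hB x).eq,
      sub_self]
  refine Module.finite_of_fg_torsion _ fun {x} =>
    ⟨⟨2, mem_nonZeroDivisors_of_ne_zero two_ne_zero⟩, Subtype.ext ?_⟩
  change (2 : ℤ) • (x : B) = 0
  rw [two_smul, ← two_mul, hB.two_eq_zero, zero_mul]

theorem IsBooleanRing.isNilCleanRing_matrix {B ι : Type*} [Ring B] [Fintype ι] [DecidableEq ι]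
    (hB : IsBooleanRing B) : IsNilCleanRing (Matrix ι ι B) := by
  let _ : BooleanRing B := { ‹Ring B› with isIdempotentElem := fun a => hB a }
  intro A
  let S := Algebra.adjoin ℤ (Set.range fun p : ι × ι => A p.1 p.2)
  have : Finite S := hB.finite_adjoin (Set.finite_range _)
  have hS : IsBooleanRing S := fun x => Subtype.ext (hB x)
  exact (hS.isNilCleanRing_matrix_of_finite (ι := ι) <|
    Matrix.of fun i j => ⟨A i j, Algebra.subset_adjoin ⟨(i, j), rfl⟩⟩).map
      (S.val : S →+* B).mapMatrix

end Boolean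

theorem theorem2p6 {R : Type*} [Ring R] (hR : IsAbelianRing R) (n : ℕ) (hn : 1 ≤ n) :
    IsNilCleanRing (Matrix (Fin n) (Fin n) R) ↔
      IsBooleanRing (R ⧸ Ring.jacobson R) ∧
        IsNilIdeal ((Ring.jacobson R).matrix (Fin n)) := by
  have : Nonempty (Fin n) := ⟨⟨0, hn⟩⟩
  refine ⟨fun h => ⟨h.isBooleanRing_quotient_jacobson hR, h.isNilIdeal_matrix_jacobson⟩,
    fun ⟨hB, hnil⟩ => ?_⟩
  let π := Ideal.Quotient.mk (Ring.jacobson R)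
  refine .of_ker_isNilpotent π.mapMatrix (mapMatrix_surjective Ideal.Quotient.mk_surjective)
    (fun A hA => hnil A ?_) hB.isNilCleanRing_matrix
  simpa only [π, Ideal.mk_ker] using mem_matrix_ker_of_mem_ker_mapMatrix hA
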